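/- Conventions. All graphs are connected. For a uniformly locally finite connected graph $\Gamma$ with path-metric $\mathrm{dist}$ and a non-empty set $U$ of vertices of $\Gamma$ (with the restricted metric), the growth function of $U$ with respect to a non-empty finite set $A\subseteq U$ is $\beta_{U,A}(n)=|\{x\in U : \mathrm{dist}(a,x)\le n \text{ for some } a\in A\}|$. For non-decreasing $f,g\colon\mathbb N\to\mathbb N$ write $f\preceq g$ if there is an integer $k>0$ with $f(n)\le k\,g(kn+k)+k$ for all $n$, and $f\sim g$ if $f\preceq g$ and $g\preceq f$. The growth rate of $U$ is the $\sim$-class of $\beta_{U,A}$, which does not depend on $A$. Let $X_0$ be a finite set of vertices of $\Gamma$ and let $W_1,W_2,\dots$ be sets of vertices. For $n\ge 1$ let $X_n$ be the set of vertices that can be joined to a vertex of $X_{n-1}$ by a path of length at most $1$ containing no vertex of $(W_1\cup\dots\cup W_n)\setminus X_{n-1}$. The graph $\Gamma$ has the constant retaining property if there is an integer $K>0$ such that for every finite set $X_0$ of vertices there are sets $W_1,W_2,\dots$ of vertices with $|W_n|\le K$ for all $n\ge1$ such that the set $U=V(\Gamma)\setminus\bigcup_{n\ge0}X_n$ is non-empty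 and has the same growth rate as $V(\Gamma)$. A finitely generated group has the constant retaining property if its Cayley graph with respect to every finite generating set has it (equivalently, with respect to some finite generating set). A finitely generated subgroup $C$ of a finitely generated group $G$ is quasi-isometrically embedded if for some finite generating set $S$ of $G$ containing a finite generating set $T$ of $C$ there is a constant $c>0$ with $\frac1c d_T(x,y)-c\le d_S(x,y)\le c\,d_T(x,y)+c$ for all $x,y\in C$, where $d_T$ and $d_S$ are the path-metrics of the Cayley graphs of $C$ with respect to $T$ and of $G$ with respect to $S$. A group is virtually cyclic if it has a cyclic subgroup of finite index. Theorem. Let $G$ be a finitely generated group, and let $A$, $B$, $C$ be subgroups of $G$ such that $C$ is a proper subgroup of both $A$ and $B$ and $G=A\ast_C B$, that is, the canonical homomorphism from the amalgamated product of $A$ and $B$ over $C$ to $G$ is an isomorphism. If $C$ is virtually cyclic and quasi-isometrically embedded in $G$, then $G$ has the constant retaining property. -/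

import Mathlib

namespace FireRetaining

/-! ### Growth rate -/

/-- `f ≼ g`: there is an integer `C > 0` with `f n ≤ C * g (C * n + C) + C` for every `n`. -/
def GrowthLE (f g : ℕ → ℕ) : Prop :=
  ∃ C : ℕ, 0 < C ∧ ∀ n, f n ≤ C * g (C * n + C) + C

/-- `f ∼ g`: equivalent growth rate. -/
def GrowthEquiv (f g : ℕ → ℕ) : Prop :=
  GrowthLE f g ∧ GrowthLE g f

/-- The set of vertices in `U` at path-distance (in `Γ`) at most `n` from some vertex of `A`. It is
meant for connected `Γ`, and is the ball about `A` in the metric space `U`, whose metric is the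
restriction of the path-metric of `Γ`. -/
def ballIn {V : Type*} (Γ : SimpleGraph V) (U A : Set V) (n : ℕ) : Set V :=
  {x | x ∈ U ∧ ∃ a ∈ A, Γ.dist a x ≤ n}

/-- The growth function of the metric space `U` (with the restricted path-metric) with respect to
`A ⊆ U`. It is meant for locally finite connected `Γ`, where balls are finite. -/
noncomputable def growthFunction {V : Type*} (Γ : SimpleGraph V) (U A : Set V) (n : ℕ) : ℕ :=
  (ballIn Γ U A n).ncard

/-- The subsets `U` and `U'` of the vertex set of `Γ`, with the restricted path-metrics, have the
same growth rate. (The growth rate does not depend on the non-empty finite sets `A`, `B`.) -/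
def SameGrowth {V : Type*} (Γ : SimpleGraph V) (U U' : Set V) : Prop :=
  ∃ A B : Set V, A.Finite ∧ A.Nonempty ∧ A ⊆ U ∧ B.Finite ∧ B.Nonempty ∧ B ⊆ U' ∧
    GrowthEquiv (growthFunction Γ U A) (growthFunction Γ U' B)

/-! ### The fire retaining game -/

/-- `W 1, W 2, …` is an `f`-strategy: at time `n ≥ 1` at most `f n` vertices are protected.
(The values `f 0` and `W 0` play no role.) -/
def IsStrategy {V : Type*} (f : ℕ → ℕ) (W : ℕ → Finset V) : Prop :=
  ∀ n, 1 ≤ n → (W n).card ≤ f n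

/-- `W 1 ∪ ⋯ ∪ W n`. -/
def chosenUpTo {V : Type*} (W : ℕ → Finset V) (n : ℕ) : Set V :=
  {v | ∃ k, 1 ≤ k ∧ k ≤ n ∧ v ∈ W k}

/-- The set `X n` of vertices on fire at time `n`, for the initial fire `X₀` of reach `r` and the
strategy `W`: the vertices of `X (n + 1)` are those joined to a vertex of `X n` by a path of length
at most `r` that contains no vertex of `(W 1 ∪ ⋯ ∪ W (n + 1)) \ X n`. -/
def onFire {V : Type*} (Γ : SimpleGraph V) (r : ℕ) (X₀ : Set V) (W : ℕ → Finset V) : ℕ → Set V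
  | 0 => X₀
  | n + 1 => {v | ∃ u ∈ onFire Γ r X₀ W n, ∃ p : Γ.Walk u v, p.length ≤ r ∧
      ∀ w ∈ p.support, w ∉ chosenUpTo W (n + 1) \ onFire Γ r X₀ W n}

/-- The vertices that never catch fire. -/
def neverOnFire {V : Type*} (Γ : SimpleGraph V) (r : ℕ) (X₀ : Set V) (W : ℕ → Finset V) : Set V :=
  (⋃ n, onFire Γ r X₀ W n)ᶜ

/-- `W` is a retaining `f`-strategy for the initial fire `X₀` of reach `r`. -/
def IsRetainingStrategy {V : Type*} (Γ : SimpleGraph V) (f : ℕ → ℕ) (r : ℕ) (X₀ : Set V)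
    (W : ℕ → Finset V) : Prop :=
  IsStrategy f W ∧ SameGrowth Γ (neverOnFire Γ r X₀ W) Set.univ

/-- The `(f, r)`-retaining property of a connected graph. -/
def HasRetainingProperty {V : Type*} (Γ : SimpleGraph V) (f : ℕ → ℕ) (r : ℕ) : Prop :=
  ∀ X₀ : Set V, X₀.Finite → ∃ W : ℕ → Finset V, IsRetainingStrategy Γ f r X₀ W

/-- The polynomial retaining property of degree `d` of a connected graph. -/
def HasPolynomialRetainingProperty {V : Type*} (Γ : SimpleGraph V) (d : ℕ) : Prop :=
  ∃ K : ℕ, 0 < K ∧ HasRetainingProperty Γ (fun n => K * n ^ d) 1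

/-- The constant retaining property of a connected graph. -/
def HasConstantRetainingProperty {V : Type*} (Γ : SimpleGraph V) : Prop :=
  HasPolynomialRetainingProperty Γ 0

/-- A finitely generated group has the constant retaining property if its Cayley graphs with
respect to finite generating sets have it. -/
def GroupHasConstantRetainingProperty (G : Type*) [Group G] : Prop :=
  Group.FG G ∧ ∀ S : Set G, S.Finite → Subgroup.closure S = ⊤ →
    HasConstantRetainingProperty (SimpleGraph.mulCayley S)

/-! ### Subgroups -/

/-- A map between the vertex sets of connected graphs is a `c`-quasi-isometric embedding for the
path-metrics. -/
def IsQuasiIsometricEmbedding {V V' : Type*} (Γ : SimpleGraph V) (Γ' : SimpleGraph V')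
    (c : ℝ) (φ : V → V') : Prop :=
  ∀ x y : V, 1 / c * (Γ.dist x y : ℝ) - c ≤ (Γ'.dist (φ x) (φ y) : ℝ) ∧
    (Γ'.dist (φ x) (φ y) : ℝ) ≤ c * (Γ.dist x y : ℝ) + c

/-- The (finitely generated) subgroup `C` is quasi-isometrically embedded in the (finitely
generated) group `G`: for some finite generating set `S` of `G` containing a finite generating set
`T` of `C`, the inclusion of Cayley graphs is a quasi-isometric embedding. -/
def IsQuasiIsometricallyEmbedded {G : Type*} [Group G] (C : Subgroup G) : Prop :=
  ∃ (S : Set G) (T : Set C), S.Finite ∧ Subgroup.closure S = ⊤ ∧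
    T.Finite ∧ Subgroup.closure T = ⊤ ∧ (fun t : C => (t : G)) '' T ⊆ S ∧
    ∃ c : ℝ, 0 < c ∧ IsQuasiIsometricEmbedding (SimpleGraph.mulCayley T)
      (SimpleGraph.mulCayley S) c (fun x : C => (x : G))

/-- A group is virtually cyclic if it has a cyclic subgroup of finite index (so finite groups are
virtually cyclic). -/
def IsVirtuallyCyclic (H : Type*) [Group H] : Prop :=
  ∃ Z : Subgroup H, IsCyclic Z ∧ Z.FiniteIndex

/-- The inclusions of the common subgroup `C` into the factors `F false` and `F true`. -/
def factorInclusion {G : Type*} [Group G] (F : Bool → Subgroup G) (C : Subgroup G)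
    (h : ∀ i, C ≤ F i) (i : Bool) : C →* F i :=
  Subgroup.inclusion (h i)

theorem subtype_comp_factorInclusion {G : Type*} [Group G] (F : Bool → Subgroup G)
    (C : Subgroup G) (h : ∀ i, C ≤ F i) (i : Bool) :
    (F i).subtype.comp (factorInclusion F C h i) = C.subtype :=
  Subgroup.subtype_comp_inclusion (h i)

/-- The canonical homomorphism from the amalgamated product `F false ∗_C F true` (the pushout of the
two inclusions of `C`) to the ambient group, restricting to the inclusions of `F false`, `F true`
and `C`. -/
def amalgamToGroup {G : Type*} [Group G] (F : Bool → Subgroup G) (C : Subgroup G)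
    (h : ∀ i, C ≤ F i) : Monoid.PushoutI (factorInclusion F C h) →* G :=
  Monoid.PushoutI.lift (fun i => (F i).subtype) C.subtype
    (subtype_comp_factorInclusion F C h)

/-- `G = A ∗_C B`: the subgroup `C` is contained in `A` and in `B`, and the canonical homomorphism
from the amalgamated product of `A` and `B` over `C` to `G` is an isomorphism. -/
def IsAmalgamatedProduct {G : Type*} [Group G] (A B C : Subgroup G) : Prop :=
  ∃ h : ∀ i : Bool, C ≤ cond i B A,
    Function.Bijective (amalgamToGroup (fun i => cond i B A) C h)

end FireRetaining

/-! In `A ∗_C B`, let `H` be the set of elements whose reduced products start in `A`. Multiplying on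
the right by a generator alters only the end of a reduced product, so `v` and `v * s` can be
separated by `H` only when `v` lies in one of finitely many cosets `C * e` (`startingIn_boundary`).
So `H` is a half-space of the Cayley graph whose boundary stays close to `C`.

Take `a ∈ A \ C` and `b ∈ B \ C`. Left multiplication by `a` carries the complement of `H` into `H`,
so a translate of `H` has the growth rate of `G` (`IsHalfSpace.sameGrowth`). The cosets of `C` by
powers of `t = a * b` are distinct, so some translate `g * H` misses the initial fire and has its
boundary as far away as desired (`IsHalfSpace.exists_translate`).

Since `C` is virtually cyclic and undistorted, balls centred on the boundary meet it in linearly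
many points, at a rate independent of `g` (`exists_ncard_coset_inter_ball_le`). Once the boundary is
farther from the fire than the fire's diameter, this gives a linear bound for balls about the fire,
with a rate that does not depend on the fire. By Hall's theorem (`exists_schedule`) a constant
number of protections per turn then secures each boundary vertex before the fire can reach it. -/

namespace FireRetaining

/-! ### Reduced products and half-spaces in amalgamated products -/

section Amalgam

variable {G : Type*} [Group G]

/-- `ReducedProduct F C i j g`: the element `g` is a product `x₁ ⋯ xₙ` with `n ≥ 1` of elements
outside `C`, taken alternately from the subgroups `F false` and `F true`, with `x₁ ∈ F i` and
`xₙ ∈ F j`. -/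
inductive ReducedProduct (F : Bool → Subgroup G) (C : Subgroup G) : Bool → Bool → G → Prop
  | single {i : Bool} {x : G} : x ∈ F i → x ∉ C → ReducedProduct F C i i x
  | snoc {i j l : Bool} {g x : G} : ReducedProduct F C i j g → j ≠ l → x ∈ F l → x ∉ C →
      ReducedProduct F C i l (g * x)

/-- The elements with a reduced product that starts in `F i`. -/
def startingIn (F : Bool → Subgroup G) (C : Subgroup G) (i : Bool) : Set G :=
  {g | ∃ j, ReducedProduct F C i j g}

variable {F : Bool → Subgroup G} {C : Subgroup G}

theorem ReducedProduct.cons {i j l : Bool} {g x : G} (hg : ReducedProduct F C i j g)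
    (hl : l ≠ i) (hx : x ∈ F l) (hxC : x ∉ C) : ReducedProduct F C l j (x * g) := by
  induction hg with
  | single hy hyC => exact .snoc (.single hx hxC) hl hy hyC
  | snoc _ hjl hy hyC ih => rw [← mul_assoc]; exact .snoc ih hjl hy hyC

theorem ReducedProduct.mul_mem_base (hF : ∀ i, C ≤ F i) {i j : Bool} {g c : G}
    (hg : ReducedProduct F C i j g) (hc : c ∈ C) : ReducedProduct F C i j (g * c) := by
  cases hg with
  | single hx hxC =>
    exact .single (mul_mem hx (hF _ hc)) fun h => hxC ((C.mul_mem_cancel_right hc).1 h)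
  | snoc hg hjl hx hxC =>
    rw [mul_assoc]
    exact .snoc hg hjl (mul_mem hx (hF _ hc)) fun h => hxC ((C.mul_mem_cancel_right hc).1 h)

/-- Only the last letter can interact with `u`. The first letter is lost only if it is also the last
one and the product collapses into `C`. -/
theorem mul_mem_startingIn_or (hF : ∀ i, C ≤ F i) {i k : Bool} {g u : G}
    (hg : g ∈ startingIn F C i) (hu : u ∈ F k) : g * u ∈ startingIn F C i ∨ g * u ∈ C := by
  obtain ⟨j, hg⟩ := hg
  by_cases hjk : j = k
  · subst hjk
    by_cases huC : g * u ∈ C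
    · exact .inr huC
    cases hg with
    | single hx _ => exact .inl ⟨_, .single (mul_mem hx hu) huC⟩
    | @snoc _ _ _ x hg hjl hx _ =>
      left
      rw [mul_assoc] at huC ⊢
      by_cases hxu : x * u ∈ C
      · exact ⟨_, hg.mul_mem_base hF hxu⟩
      · exact ⟨_, .snoc hg hjl (mul_mem hx hu) hxu⟩
  · by_cases huC : u ∈ C
    · exact .inl ⟨_, hg.mul_mem_base hF huC⟩
    · exact .inl ⟨_, .snoc hg hjk hu huC⟩

theorem mem_base_or_startingIn_mul (hF : ∀ i, C ≤ F i) {k : Bool} {g u : G} (hu : u ∈ F k)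
    (hg : g ∈ C ∨ ∃ i, g ∈ startingIn F C i) :
    g * u ∈ C ∨ ∃ i, g * u ∈ startingIn F C i := by
  rcases hg with hg | ⟨i, hg⟩
  · by_cases h : g * u ∈ C
    · exact .inl h
    · exact .inr ⟨k, k, .single (mul_mem (hF _ hg) hu) h⟩
  · rcases mul_mem_startingIn_or hF hg hu with h | h
    · exact .inr ⟨i, h⟩
    · exact .inl h

theorem amalgam_induction (hF : ∀ i, C ≤ F i)
    (hsurj : Function.Surjective (amalgamToGroup F C hF)) {p : G → Prop}
    (factor : ∀ i, ∀ u ∈ F i, p u) (mul : ∀ x y, p x → p y → p (x * y)) (g : G) : p g := by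
  obtain ⟨w, rfl⟩ := hsurj g
  induction w using Monoid.PushoutI.induction_on with
  | of i u => simpa [amalgamToGroup] using factor i u u.2
  | base c => simpa [amalgamToGroup] using factor true c (hF _ c.2)
  | mul x y hx hy => simpa using mul _ _ hx hy

theorem ReducedProduct.exists_neWord {i j : Bool} {g : G} (hg : ReducedProduct F C i j g) :
    ∃ w : Monoid.CoprodI.NeWord (fun i => F i) i j,
      (∀ l ∈ w.toList, (l.2 : G) ∉ C) ∧
        Monoid.CoprodI.lift (fun i => (F i).subtype) w.prod = g := by
  induction hg with
  | @single x hx hxC =>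
    refine ⟨.singleton ⟨x, hx⟩ fun h => hxC ?_, ?_, ?_⟩
    · rw [show x = 1 from congrArg Subtype.val h]; exact one_mem C
    · simpa [Monoid.CoprodI.NeWord.toList] using hxC
    · simp
  | @snoc _ _ _ x _ hjl hx hxC ih =>
    obtain ⟨w, hw, rfl⟩ := ih
    refine ⟨.append w hjl (.singleton ⟨x, hx⟩ fun h => hxC ?_), ?_, ?_⟩
    · rw [show x = 1 from congrArg Subtype.val h]; exact one_mem C
    · intro l hl
      simp only [Monoid.CoprodI.NeWord.toList, List.mem_append, List.mem_singleton] at hl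
      rcases hl with hl | rfl
      · exact hw l hl
      · exact hxC
    · simp

/-- This is the normal form theorem for pushouts, transported along the injection into `G`. -/
theorem ReducedProduct.notMem_base (hF : ∀ i, C ≤ F i)
    (hinj : Function.Injective (amalgamToGroup F C hF)) {i j : Bool} {g : G}
    (hg : ReducedProduct F C i j g) : g ∉ C := by
  intro hgC
  obtain ⟨w, hw, rfl⟩ := hg.exists_neWord
  have hred : Monoid.PushoutI.Reduced (factorInclusion F C hF) w.toWord := by
    rintro l hl ⟨c, hc⟩
    apply hw l hl
    rw [← hc]
    exact c.2
  have hlift : ∀ x, amalgamToGroup F C hF (Monoid.PushoutI.ofCoprodI x) =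
      Monoid.CoprodI.lift (fun i => (F i).subtype) x := by
    intro x
    induction x using Monoid.CoprodI.induction_on with
    | one => simp
    | of i x => simp [amalgamToGroup]
    | mul x y hx hy => simp [hx, hy]
  have hmem : Monoid.PushoutI.ofCoprodI w.toWord.prod ∈
      (Monoid.PushoutI.base (factorInclusion F C hF)).range := by
    refine ⟨⟨_, hgC⟩, hinj ?_⟩
    rw [hlift]
    simp only [amalgamToGroup, Monoid.PushoutI.lift_base]
    rfl
  have := hred.eq_empty_of_mem_range (fun i => Subgroup.inclusion_injective (hF i)) hmem
  exact w.toList_ne_nil (congrArg Monoid.CoprodI.Word.toList this)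

/-- For `u` in a factor, membership changes only if `v * u ∈ C` or `v ∈ C`. For a product `x * y`, a
change occurs at the step from `v` to `v * x` or at the step from `v * x` to `v * x * y`. -/
theorem startingIn_boundary (hF : ∀ i, C ≤ F i)
    (hsurj : Function.Surjective (amalgamToGroup F C hF)) (i : Bool) (g : G) :
    ∃ E : Set G, E.Finite ∧ ∀ v, ¬(v ∈ startingIn F C i ↔ v * g ∈ startingIn F C i) →
      ∃ c ∈ C, ∃ e ∈ E, v = c * e := by
  induction g using amalgam_induction hF hsurj with
  | factor k u hu =>
    refine ⟨{1, u⁻¹}, by simp, fun v hv => ?_⟩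
    by_cases h : v ∈ startingIn F C i
    · rcases mul_mem_startingIn_or hF h hu with h' | h'
      · exact absurd (iff_of_true h h') hv
      · exact ⟨_, h', u⁻¹, by simp, by group⟩
    · have h' : v * u ∈ startingIn F C i := by tauto
      rcases mul_mem_startingIn_or hF h' (inv_mem hu) with h'' | h''
      · rw [mul_inv_cancel_right] at h''; exact absurd h'' h
      · rw [mul_inv_cancel_right] at h''; exact ⟨v, h'', 1, by simp, by simp⟩
  | mul x y hx hy =>
    obtain ⟨E, hE, hx⟩ := hx
    obtain ⟨E', hE', hy⟩ := hy
    refine ⟨E ∪ (fun e => e * x⁻¹) '' E', hE.union (hE'.image _), fun v hv => ?_⟩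
    by_cases h : v ∈ startingIn F C i ↔ v * x ∈ startingIn F C i
    · rw [h, ← mul_assoc] at hv
      obtain ⟨c, hc, e, he, hce⟩ := hy _ hv
      exact ⟨c, hc, e * x⁻¹, .inr ⟨e, he, rfl⟩, by rw [← mul_assoc, ← hce]; group⟩
    · obtain ⟨c, hc, e, he, hce⟩ := hx _ h
      exact ⟨c, hc, e, .inl he, hce⟩

/-- A half-space `H` of an amalgamated product over `C`: right translation moves it only within
finitely many cosets of `C`, the translation by `a` moves its complement into it, and the powers of
`t` move it properly into itself. -/
structure IsHalfSpace (C : Subgroup G) (H : Set G) (a t : G) : Prop where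
  boundary : ∀ g : G, ∃ E : Set G, E.Finite ∧ ∀ v, ¬(v ∈ H ↔ v * g ∈ H) →
    ∃ c ∈ C, ∃ e ∈ E, v = c * e
  swap : ∀ v, v ∉ H → a * v ∈ H
  shift : ∀ v ∈ H, t * v ∈ H
  pow_notMem : ∀ n, n ≠ 0 → t ^ n ∉ C
  one_notMem : (1 : G) ∉ H

theorem IsAmalgamatedProduct.exists_isHalfSpace {A B C : Subgroup G}
    (hG : IsAmalgamatedProduct A B C) (hCA : C < A) (hCB : C < B) :
    ∃ (H : Set G) (a t : G), IsHalfSpace C H a t := by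
  obtain ⟨hF, hinj, hsurj⟩ := hG
  obtain ⟨-, a, ha, haC⟩ := SetLike.lt_iff_le_and_exists.1 hCA
  obtain ⟨-, b, hb, hbC⟩ := SetLike.lt_iff_le_and_exists.1 hCB
  have hshift : ∀ v ∈ startingIn (fun i => cond i B A) C false,
      a * b * v ∈ startingIn (fun i => cond i B A) C false := by
    rintro v ⟨j, hv⟩
    rw [mul_assoc]
    exact ⟨j, (hv.cons (l := true) (by simp) hb hbC).cons (by simp) ha haC⟩
  have hab : a * b ∈ startingIn (fun i => cond i B A) C false :=
    ⟨true, .snoc (.single ha haC) (by simp) hb hbC⟩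
  have hpow : ∀ n, (a * b) ^ (n + 1) ∈ startingIn (fun i => cond i B A) C false := by
    intro n
    induction n with
    | zero => simpa using hab
    | succ n ih => rw [pow_succ']; exact hshift _ ih
  refine ⟨startingIn (fun i => cond i B A) C false, a, a * b,
    startingIn_boundary hF hsurj false, fun v hv => ?_, hshift, fun n hn => ?_, ?_⟩
  -- `C` and the two sets `startingIn` together contain `1` and are stable under right
  -- multiplication, so they cover `G`.
  · have hcover : ∀ g : G, ∀ v : G, (v ∈ C ∨ ∃ i, v ∈ startingIn (fun i => cond i B A) C i) →
        (v * g ∈ C ∨ ∃ i, v * g ∈ startingIn (fun i => cond i B A) C i) := by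
      intro g
      induction g using amalgam_induction hF hsurj with
      | factor k u hu => exact fun v hv => mem_base_or_startingIn_mul hF hu hv
      | mul x y hx hy => intro v hv; rw [← mul_assoc]; exact hy _ (hx _ hv)
    have := hcover v 1 (.inl (one_mem C))
    rw [one_mul] at this
    rcases this with h | ⟨i, h⟩
    · exact ⟨false, .single (mul_mem ha (hF false h))
        fun h' => haC ((C.mul_mem_cancel_right h).1 h')⟩
    · cases i with
      | false => exact absurd h hv
      | true =>
        obtain ⟨j, h⟩ := h
        exact ⟨j, h.cons (by simp) ha haC⟩
  · obtain ⟨n, rfl⟩ := Nat.exists_eq_succ_of_ne_zero hn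
    obtain ⟨j, h⟩ := hpow n
    exact h.notMem_base hF hinj
  · rintro ⟨j, h⟩
    exact h.notMem_base hF hinj (one_mem C)

/-- The cosets `t ^ n * C` are pairwise disjoint, so each point of `Y` lies in at most one of them.
-/
theorem finite_setOf_pow_mul_mem {t : G} (ht : ∀ n, n ≠ 0 → t ^ n ∉ C) {Y : Set G}
    (hY : Y.Finite) : {n : ℕ | ∃ c ∈ C, t ^ n * c ∈ Y}.Finite := by
  have key : ∀ m n : ℕ, ∀ c ∈ C, ∀ c' ∈ C, t ^ m * c = t ^ n * c' → m ≤ n := by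
    intro m n c hc c' hc' h
    by_contra! hlt
    obtain ⟨k, rfl⟩ := Nat.exists_eq_add_of_lt hlt
    apply ht (k + 1) (by simp)
    have : t ^ (k + 1) = c' * c⁻¹ := by
      rw [add_assoc, pow_add, mul_assoc] at h
      rw [eq_mul_inv_iff_mul_eq]
      exact mul_left_cancel h
    rw [this]
    exact mul_mem hc' (inv_mem hc)
  refine (hY.biUnion (t := fun y => {n : ℕ | ∃ c ∈ C, t ^ n * c = y}) fun y _ =>
    Set.Subsingleton.finite ?_).subset ?_
  · rintro m ⟨c, hc, h⟩ n ⟨c', hc', h'⟩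
    exact le_antisymm (key _ _ c hc c' hc' (h.trans h'.symm))
      (key _ _ c' hc' c hc (h'.trans h.symm))
  · rintro n ⟨c, hc, h⟩
    exact Set.mem_biUnion h ⟨c, hc, rfl⟩

/-- A translate of a half-space that avoids `X`, whose boundary coset avoids `Y`. -/
theorem IsHalfSpace.exists_translate {H : Set G} {a t : G} (hH : IsHalfSpace C H a t)
    {X Y : Set G} (hX : X.Finite) (hY : Y.Finite) :
    ∃ g : G, (∀ x ∈ X, g⁻¹ * x ∉ H) ∧ ∀ c ∈ C, g * c ∉ Y := by
  choose E hE hEb using hH.boundary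
  -- If `x ∈ t ^ n * H`, then `H` separates `t⁻ⁿ * x` from `t⁻ⁿ`, which forces `t ^ n * C` to meet
  -- the finite set `x * (E x⁻¹)⁻¹`. Both requirements thus ask `t ^ n * C` to avoid a finite set.
  have hfin : (Y ∪ ⋃ x ∈ X, (fun e => x * e⁻¹) '' E x⁻¹).Finite :=
    hY.union (hX.biUnion fun x _ => (hE _).image _)
  obtain ⟨n, hn⟩ := (finite_setOf_pow_mul_mem hH.pow_notMem hfin).exists_notMem
  refine ⟨t ^ n, fun x hx hxH => hn ?_, fun c hc h => hn ⟨c, hc, .inl h⟩⟩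
  have hmul : ∀ k : ℕ, ∀ v ∈ H, t ^ k * v ∈ H := by
    intro k
    induction k with
    | zero => simp
    | succ k ih => intro v hv; rw [pow_succ', mul_assoc]; exact hH.shift _ (ih _ hv)
  have hnot : (t ^ n)⁻¹ * x * x⁻¹ ∉ H := fun h => hH.one_notMem (by simpa using hmul n _ h)
  obtain ⟨c, hc, e, he, hce⟩ := hEb x⁻¹ _ (fun h => hnot (h.1 hxH))
  refine ⟨c, hc, .inr (Set.mem_biUnion hx ⟨e, he, ?_⟩)⟩
  have : x = t ^ n * (c * e) := by rw [← hce]; group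
  change x * e⁻¹ = t ^ n * c
  rw [this]; group

end Amalgam


/-! ### Metric and growth estimates in Cayley graphs -/

section Cayley

open SimpleGraph

theorem exists_adj_of_dist_le_succ {V : Type*} {Γ : SimpleGraph V} (hΓ : Γ.Connected)
    {a x : V} {n : ℕ} (h : Γ.dist a x ≤ n + 1) :
    x = a ∨ ∃ y, Γ.dist a y ≤ n ∧ Γ.Adj y x := by
  obtain ⟨p, hp⟩ := hΓ.exists_walk_length_eq_dist x a
  cases p with
  | nil => exact .inl rfl
  | @cons _ y _ hxy q =>
    refine .inr ⟨y, ?_, hxy.symm⟩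
    rw [dist_comm, ← hp, Walk.length_cons] at h
    rw [dist_comm]
    exact (dist_le q).trans (by omega)

variable {G : Type*} [Group G] {S : Set G}

theorem mulCayley_connected (hS : Subgroup.closure S = ⊤) : (mulCayley S).Connected := by
  have hstep : ∀ s ∈ S, ∀ x, (mulCayley S).Reachable x (x * s) := by
    intro s hs x
    by_cases h : x = x * s
    · rw [← h]
    · exact Adj.reachable ((mulCayley_adj S _ _).2 ⟨h, .inl (by simpa using hs)⟩)
  have hone : ∀ g, ∀ x, (mulCayley S).Reachable x (x * g) := by
    intro g
    have hg : g ∈ Subgroup.closure S := hS ▸ Subgroup.mem_top g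
    induction hg using Subgroup.closure_induction with
    | mem s hs => exact hstep s hs
    | one => simp
    | mul y z _ _ hy hz => intro x; rw [← mul_assoc]; exact (hy x).trans (hz _)
    | inv y _ hy => intro x; simpa using (hy (x * y⁻¹)).symm
  have : Nonempty G := ⟨1⟩
  exact ⟨fun x y => by simpa using hone (x⁻¹ * y) x⟩

theorem mulCayley_dist_mul_left (hS : Subgroup.closure S = ⊤) (g x y : G) :
    (mulCayley S).dist (g * x) (g * y) = (mulCayley S).dist x y := by
  have key : ∀ g x y : G, (mulCayley S).dist (g * x) (g * y) ≤ (mulCayley S).dist x y := by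
    intro g x y
    obtain ⟨p, hp⟩ := (mulCayley_connected hS).exists_walk_length_eq_dist x y
    let f : mulCayley S →g mulCayley S := ⟨fun z => g * z, fun h => mulCayley_adj_mul_iff_right.2 h⟩
    rw [← hp, ← Walk.length_map f p]
    exact dist_le (p.map f)
  refine le_antisymm (key g x y) ?_
  simpa using key g⁻¹ (g * x) (g * y)

theorem mulCayley_finite_ball (hS : Subgroup.closure S = ⊤) (hfin : S.Finite) (a : G) (n : ℕ) :
    {x | (mulCayley S).dist a x ≤ n}.Finite := by
  induction n with
  | zero =>
    refine (Set.finite_singleton a).subset fun x hx => ?_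
    exact ((mulCayley_connected hS).dist_eq_zero_iff.1 (Nat.le_zero.1 hx)).symm
  | succ n ih =>
    refine ((Set.finite_singleton a).union
      (Set.Finite.image2 (fun x s => x * s) ih (hfin.union hfin.inv))).subset fun x hx => ?_
    rcases exists_adj_of_dist_le_succ (mulCayley_connected hS) hx with rfl | ⟨y, hy, hyx⟩
    · exact .inl rfl
    · refine .inr ⟨y, hy, y⁻¹ * x, ?_, by simp⟩
      rcases ((mulCayley_adj S _ _).1 hyx).2 with h | h
      · exact .inl h
      · exact .inr (by simpa using h)

theorem exists_mulCayley_dist_le_mul {S' : Set G} (hS : Subgroup.closure S = ⊤) (hfin : S.Finite)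
    (hS' : Subgroup.closure S' = ⊤) :
    ∃ M : ℕ, ∀ x y, (mulCayley S').dist x y ≤ M * (mulCayley S).dist x y := by
  obtain ⟨M, hM⟩ := (hfin.image fun s => (mulCayley S').dist 1 s).bddAbove
  have hadj : ∀ x y, (mulCayley S).Adj x y → (mulCayley S').dist x y ≤ M := by
    intro x y h
    rcases ((mulCayley_adj S _ _).1 h).2 with h | h
    · rw [← mulCayley_dist_mul_left hS' x⁻¹, inv_mul_cancel]
      exact hM ⟨_, h, rfl⟩
    · rw [← mulCayley_dist_mul_left hS' y⁻¹, inv_mul_cancel, dist_comm]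
      exact hM ⟨_, h, rfl⟩
  refine ⟨M, fun x y => ?_⟩
  obtain ⟨p, hp⟩ := (mulCayley_connected hS).exists_walk_length_eq_dist x y
  rw [← hp]
  clear hp
  induction p with
  | nil => simp
  | @cons u v w h p ih =>
    rw [Walk.length_cons, mul_add_one, add_comm]
    exact ((mulCayley_connected hS').dist_triangle).trans (add_le_add (hadj _ _ h) ih)

/-- Balls in virtually cyclic groups grow at most linearly. -/
theorem IsVirtuallyCyclic.exists_ball_ncard_le (hG : IsVirtuallyCyclic G)
    (hS : Subgroup.closure S = ⊤) (hfin : S.Finite) :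
    ∃ k : ℕ, ∀ n, {x | (mulCayley S).dist 1 x ≤ n}.ncard ≤ k * (n + 1) := by
  obtain ⟨Z, hZ, hZfin⟩ := hG
  obtain ⟨z, hz⟩ := hZ.exists_generator
  obtain ⟨R, hR, -⟩ := Z.exists_isComplement_right 1
  have hRfin : R.Finite := (hR.finite_right_iff).2 hZfin
  have hdecomp : ∀ x : G, ∃ i : ℤ, ∃ r ∈ R, x = (z : G) ^ i * r := by
    intro x
    obtain ⟨⟨⟨y, hy⟩, ⟨r, hr⟩⟩, rfl⟩ := hR.surjective x
    obtain ⟨i, hi⟩ := Subgroup.mem_zpowers_iff.1 (hz ⟨y, hy⟩)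
    refine ⟨i, r, hr, ?_⟩
    rw [← Subgroup.coe_zpow, hi]
  choose i r hr hir using hdecomp
  -- `I` bounds the change of the exponent of `z` along one edge. The inserted `1`s cover the
  -- starting point `i 1`.
  obtain ⟨I, hI⟩ := ((Set.Finite.image2 (fun x s => (i (x * s)).natAbs) (hRfin.insert 1)
    ((hfin.union hfin.inv).insert 1))).bddAbove
  have hball : ∀ n : ℕ, ∀ x, (mulCayley S).dist 1 x ≤ n →
      ∃ j : ℤ, j.natAbs ≤ I * (n + 1) ∧ ∃ s ∈ R, x = (z : G) ^ j * s := by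
    intro n
    induction n with
    | zero =>
      intro x hx
      obtain rfl := (mulCayley_connected hS).dist_eq_zero_iff.1 (Nat.le_zero.1 hx)
      refine ⟨i 1, ?_, r 1, hr 1, hir 1⟩
      simpa using hI ⟨1, by simp, 1, by simp, rfl⟩
    | succ n ih =>
      intro x hx
      rcases exists_adj_of_dist_le_succ (mulCayley_connected hS) hx with rfl | ⟨y, hy, hyx⟩
      · obtain ⟨j, hj, h⟩ := ih 1 (by simp)
        exact ⟨j, hj.trans (Nat.mul_le_mul_left _ (by omega)), h⟩
      · obtain ⟨j, hj, s, hs, rfl⟩ := ih y hy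
        set w := (z : G) ^ j * s with hw
        have hmem : w⁻¹ * x ∈ S ∪ S⁻¹ := by
          rcases ((mulCayley_adj S _ _).1 hyx).2 with h | h
          · exact .inl h
          · exact .inr (by simpa using h)
        have hle : (i (s * (w⁻¹ * x))).natAbs ≤ I :=
          hI ⟨s, .inr hs, w⁻¹ * x, .inr hmem, rfl⟩
        refine ⟨j + i (s * (w⁻¹ * x)), ?_, r (s * (w⁻¹ * x)), hr _, ?_⟩
        · refine (Int.natAbs_add_le _ _).trans ?_
          calc _ ≤ I * (n + 1) + I := add_le_add hj hle
            _ = I * (n + 1 + 1) := by ring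
        · rw [zpow_add, mul_assoc, ← hir, ← mul_assoc, ← hw, mul_inv_cancel_left]
  refine ⟨(2 * I + 1) * R.ncard, fun n => ?_⟩
  have hsub : {x | (mulCayley S).dist 1 x ≤ n} ⊆
      (fun p : ℤ × G => (z : G) ^ p.1 * p.2) ''
        ((Finset.Icc (-(I * (n + 1) : ℕ) : ℤ) (I * (n + 1) : ℕ) : Set ℤ) ×ˢ R) := by
    intro x hx
    obtain ⟨j, hj, s, hs, rfl⟩ := hball n x hx
    refine ⟨(j, s), ⟨?_, hs⟩, rfl⟩
    simp only [Finset.coe_Icc, Set.mem_Icc]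
    omega
  have hprod := (Finset.finite_toSet
    (Finset.Icc (-(I * (n + 1) : ℕ) : ℤ) (I * (n + 1) : ℕ))).prod hRfin
  refine (Set.ncard_le_ncard hsub (hprod.image _)).trans ((Set.ncard_image_le hprod).trans ?_)
  rw [Set.ncard_prod, Set.ncard_coe_finset, Int.card_Icc]
  have : ((I * (n + 1) : ℕ) + 1 - (-(I * (n + 1) : ℕ) : ℤ)).toNat ≤ (2 * I + 1) * (n + 1) := by
    rw [Int.toNat_le]
    push_cast
    nlinarith
  calc _ ≤ (2 * I + 1) * (n + 1) * R.ncard := Nat.mul_le_mul_right _ this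
    _ = _ := by ring

/-- A finite union of translates of a quasi-isometrically embedded virtually cyclic subgroup meets
balls centred on it in linearly many points. -/
theorem exists_ncard_coset_inter_ball_le {C : Subgroup G} (hCyc : IsVirtuallyCyclic C)
    (hQI : IsQuasiIsometricallyEmbedded C) (hS : Subgroup.closure S = ⊤) (hfin : S.Finite)
    {E : Set G} (hE : E.Finite) :
    ∃ K : ℕ, ∀ c₀ ∈ C, ∀ e₀ ∈ E, ∀ g : G, ∀ r : ℕ,
      {v | (∃ c ∈ C, ∃ e ∈ E, v = g * (c * e)) ∧
        (mulCayley S).dist (g * (c₀ * e₀)) v ≤ r}.ncard ≤ K * (r + 1) := by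
  obtain ⟨S', T, hS'fin, hS', hTfin, hT, -, q, hq, hqi⟩ := hQI
  obtain ⟨M, hM⟩ := exists_mulCayley_dist_le_mul hS hfin hS'
  obtain ⟨k, hk⟩ := hCyc.exists_ball_ncard_le hT hTfin
  obtain ⟨L, hL⟩ := (hE.image fun e => (mulCayley S).dist 1 e).bddAbove
  have hconn := mulCayley_connected hS
  -- `2 * L` pays for dropping `e₀` and `e`, `M` for changing generators, and `q` for the distortion
  -- of `C`.
  obtain ⟨N, hN⟩ := exists_nat_ge (q * (M * (2 * L + 1) + q))
  have hdist : ∀ c₀ c : C, ∀ e₀ ∈ E, ∀ e ∈ E, ∀ r : ℕ,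
      (mulCayley S).dist ((c₀ : G) * e₀) (c * e) ≤ r →
        (mulCayley T).dist 1 (c₀⁻¹ * c) ≤ N * (r + 1) := by
    intro c₀ c e₀ he₀ e he r hr
    have hLe : ∀ x : G, ∀ e ∈ E, (mulCayley S).dist x (x * e) ≤ L := by
      intro x e he
      have := mulCayley_dist_mul_left hS x 1 e
      rw [mul_one] at this
      rw [this]
      exact hL ⟨e, he, rfl⟩
    have h1 : (mulCayley S).dist (c₀ : G) c ≤ 2 * L + r := by
      have h2 := hconn.dist_triangle (u := (c₀ : G)) (v := c₀ * e₀) (w := c)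
      have h3 := hconn.dist_triangle (u := (c₀ : G) * e₀) (v := c * e) (w := c)
      have h4 := hLe c₀ e₀ he₀
      have h5 := hLe c e he
      rw [dist_comm] at h5
      omega
    have h2 : (mulCayley S').dist (c₀ : G) c ≤ M * (2 * L + r) :=
      (hM _ _).trans (Nat.mul_le_mul_left _ h1)
    have h3 := (hqi c₀ c).1
    have h4 : ((mulCayley S').dist (c₀ : G) c : ℝ) ≤ M * (2 * L + r) := by exact_mod_cast h2
    have h5 : (mulCayley T).dist 1 (c₀⁻¹ * c) = (mulCayley T).dist c₀ c := by
      rw [← mulCayley_dist_mul_left hT c₀]; simp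
    rw [h5]
    have h6 : ((mulCayley T).dist c₀ c : ℝ) ≤ q * (M * (2 * L + r) + q) := by
      have h7 : 1 / q * ((mulCayley T).dist c₀ c : ℝ) ≤ M * (2 * L + r) + q := by
        linarith
      rwa [one_div_mul_eq_div, div_le_iff₀' hq] at h7
    have h8 : q * (M * (2 * L + r) + q) ≤ q * (M * (2 * L + 1) + q) * (r + 1) := by
      rw [mul_assoc]
      refine mul_le_mul_of_nonneg_left ?_ hq.le
      have : (0 : ℝ) ≤ M * L * r := by positivity
      have : (0 : ℝ) ≤ q * r := by positivity
      have : (0 : ℝ) ≤ (M : ℝ) := by positivity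
      nlinarith
    have h9 : q * (M * (2 * L + 1) + q) * (r + 1) ≤ (N : ℝ) * (r + 1) :=
      mul_le_mul_of_nonneg_right hN (by positivity)
    exact_mod_cast h6.trans (h8.trans h9)
  refine ⟨k * (N + 1) * E.ncard, fun c₀ hc₀ e₀ he₀ g r => ?_⟩
  have hprod := (mulCayley_finite_ball hT hTfin 1 (N * (r + 1))).prod hE
  have hsub : {v | (∃ c ∈ C, ∃ e ∈ E, v = g * (c * e)) ∧
        (mulCayley S).dist (g * (c₀ * e₀)) v ≤ r} ⊆
      (fun p : C × G => g * (c₀ * p.1 * p.2)) ''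
        ({x | (mulCayley T).dist 1 x ≤ N * (r + 1)} ×ˢ E) := by
    rintro _ ⟨⟨c, hc, e, he, rfl⟩, hr⟩
    rw [mulCayley_dist_mul_left hS] at hr
    have hd := hdist ⟨c₀, hc₀⟩ ⟨c, hc⟩ e₀ he₀ e he r hr
    refine ⟨((⟨c₀, hc₀⟩ : C)⁻¹ * (⟨c, hc⟩ : C), e), ⟨hd, he⟩, ?_⟩
    simp
  refine (Set.ncard_le_ncard hsub (hprod.image _)).trans ((Set.ncard_image_le hprod).trans ?_)
  rw [Set.ncard_prod]
  calc _ ≤ k * (N * (r + 1) + 1) * E.ncard := Nat.mul_le_mul_right _ (hk _)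
    _ ≤ k * ((N + 1) * (r + 1)) * E.ncard := by gcongr; nlinarith
    _ = _ := by ring

end Cayley


/-! ### Protecting a boundary in time -/

section Game

/-- Tasks `i` with deadlines `ρ i ≥ 1` can be carried out at a rate of `K` per unit of time if at
most `K * n` of them are due by time `n`. -/
theorem exists_schedule {ι : Type*} {K : ℕ} {ρ : ι → ℕ}
    (hfin : ∀ n, {i | ρ i ≤ n}.Finite) (hcard : ∀ n, {i | ρ i ≤ n}.ncard ≤ K * n) :
    ∃ W : ℕ → Finset ι, (∀ n, (W n).card ≤ K) ∧ ∀ i, ∃ k, 1 ≤ k ∧ k ≤ ρ i ∧ i ∈ W k := by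
  classical
  -- Hall's condition, with `K` slots at each time: all tasks in `s` are due by the latest deadline
  -- `ρ i`, so there are at most `K * ρ i` of them, and task `i` alone has that many slots.
  have hall : ∀ s : Finset ι,
      s.card ≤ (s.biUnion fun i => Finset.Icc 1 (ρ i) ×ˢ Finset.range K).card := by
    intro s
    rcases s.eq_empty_or_nonempty with rfl | hs
    · simp
    obtain ⟨i, hi, hmax⟩ := s.exists_max_image ρ hs
    calc s.card = (s : Set ι).ncard := (Set.ncard_coe_finset s).symm
      _ ≤ {j | ρ j ≤ ρ i}.ncard := Set.ncard_le_ncard (fun j hj => hmax j hj) (hfin _)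
      _ ≤ K * ρ i := hcard _
      _ = (Finset.Icc 1 (ρ i) ×ˢ Finset.range K).card := by simp [mul_comm]
      _ ≤ _ := Finset.card_le_card
        (Finset.subset_biUnion_of_mem (fun i => Finset.Icc 1 (ρ i) ×ˢ Finset.range K) hi)
  obtain ⟨f, hinj, hf⟩ := (Finset.all_card_le_biUnion_card_iff_exists_injective _).1 hall
  simp only [Finset.mem_product, Finset.mem_Icc, Finset.mem_range] at hf
  have hmaps : ∀ n, Set.MapsTo (fun i => (f i).2) {i | (f i).1 = n} (Finset.range K : Set ℕ) :=
    fun n i _ => by simpa using (hf i).2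
  have hinjOn : ∀ n, Set.InjOn (fun i => (f i).2) {i | (f i).1 = n} :=
    fun n i hi j hj h => hinj (Prod.ext (hi.trans hj.symm) h)
  have hWfin : ∀ n, {i | (f i).1 = n}.Finite :=
    fun n => Set.Finite.of_injOn (hmaps n) (hinjOn n) (Finset.finite_toSet _)
  refine ⟨fun n => (hWfin n).toFinset, fun n => ?_, fun i => ⟨(f i).1, (hf i).1.1, (hf i).1.2, ?_⟩⟩
  · rw [← Set.ncard_eq_toFinset_card _ (hWfin n)]
    simpa using Set.ncard_le_ncard_of_injOn _ (hmaps n) (hinjOn n) (Finset.finite_toSet _)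
  · simp

variable {V : Type*} {Γ : SimpleGraph V}

/-- If the inner vertex boundary of `H` meets the balls about `X₀` in linearly many points, it can
be protected before a fire starting at `X₀` reaches it. -/
theorem exists_isStrategy_subset_neverOnFire (hΓ : Γ.Connected) {H X₀ : Set V}
    (hX₀ : ∀ x ∈ X₀, x ∉ H) {K : ℕ}
    (hfin : ∀ n, {v | (v ∈ H ∧ ∃ u, u ∉ H ∧ Γ.Adj u v) ∧ ∃ x ∈ X₀, Γ.dist x v ≤ n}.Finite)
    (hcard : ∀ n,
      {v | (v ∈ H ∧ ∃ u, u ∉ H ∧ Γ.Adj u v) ∧ ∃ x ∈ X₀, Γ.dist x v ≤ n}.ncard ≤ K * n) :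
    ∃ W : ℕ → Finset V, (∀ n, (W n).card ≤ K) ∧ H ⊆ neverOnFire Γ 1 X₀ W := by
  classical
  -- The clause `∃ x ∈ X₀, True` makes `X₀` non-empty, so that the distance to `X₀` is available as
  -- a deadline.
  let P := {v : V // (v ∈ H ∧ ∃ u, u ∉ H ∧ Γ.Adj u v) ∧ ∃ x ∈ X₀, True}
  have hP : ∀ v : P, ∃ m, (∃ x ∈ X₀, Γ.dist x v ≤ m) ∧ ∀ n, (∃ x ∈ X₀, Γ.dist x v ≤ n) → m ≤ n := by
    rintro ⟨v, -, x, hx, -⟩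
    have hex : ∃ m, ∃ x ∈ X₀, Γ.dist x v ≤ m := ⟨_, x, hx, le_rfl⟩
    exact ⟨Nat.find hex, Nat.find_spec hex, fun n hn => Nat.find_min' hex hn⟩
  choose ρ hρ hρmin using hP
  have hsub : ∀ n, Subtype.val '' {v | ρ v ≤ n} ⊆
      {v | (v ∈ H ∧ ∃ u, u ∉ H ∧ Γ.Adj u v) ∧ ∃ x ∈ X₀, Γ.dist x v ≤ n} := by
    rintro n _ ⟨v, hv, rfl⟩
    obtain ⟨x, hx, h⟩ := hρ v
    exact ⟨v.2.1, x, hx, h.trans hv⟩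
  obtain ⟨W, hWcard, hW⟩ := exists_schedule (K := K) (ρ := ρ)
    (fun n => ((hfin n).subset (hsub n)).of_finite_image Subtype.val_injective.injOn)
    (fun n => by
      rw [← Set.ncard_image_of_injective _ Subtype.val_injective]
      exact (Set.ncard_le_ncard (hsub n) (hfin n)).trans (hcard n))
  let W' : ℕ → Finset V := fun n => (W n).image Subtype.val
  have hfire : ∀ n, ∀ v ∈ onFire Γ 1 X₀ W' n, v ∉ H ∧ ∃ x ∈ X₀, Γ.dist x v ≤ n := by
    intro n
    induction n with
    | zero => exact fun v hv => ⟨hX₀ v hv, v, hv, by simp⟩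
    | succ n ih =>
      rintro v ⟨u, hu, p, hp, hsupp⟩
      obtain ⟨huH, x, hx, hxu⟩ := ih u hu
      have hxv : Γ.dist x v ≤ n + 1 :=
        hΓ.dist_triangle.trans (add_le_add hxu ((SimpleGraph.dist_le p).trans hp))
      refine ⟨fun hvH => ?_, x, hx, hxv⟩
      -- A path of length at most `1` entering `H` is an edge, so `v` is a boundary vertex, already
      -- protected by time `n + 1`.
      have hadj : Γ.Adj u v := by
        rw [← SimpleGraph.dist_eq_one_iff_adj]
        have : u ≠ v := fun h => huH (h ▸ hvH)
        have := hΓ.pos_dist_of_ne this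
        have := (SimpleGraph.dist_le p).trans hp
        omega
      let v' : P := ⟨v, ⟨hvH, u, huH, hadj⟩, x, hx, trivial⟩
      obtain ⟨k, hk, hkρ, hvk⟩ := hW v'
      exact hsupp v p.end_mem_support
        ⟨⟨k, hk, hkρ.trans (hρmin v' _ ⟨x, hx, hxv⟩), Finset.mem_image.2 ⟨v', hvk, rfl⟩⟩,
          fun h => (ih v h).1 hvH⟩
  refine ⟨W', fun n => Finset.card_image_le.trans (hWcard n), fun v hv h => ?_⟩
  obtain ⟨n, hn⟩ := Set.mem_iUnion.1 h
  exact (hfire n v hn).1 hv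

end Game

/-! ### Half-spaces retain the fire -/

open SimpleGraph

variable {G : Type*} [Group G] {S : Set G} {C : Subgroup G} {H : Set G} {a t : G}

/-- A set that contains a translate of a half-space has the same growth rate as the group. -/
theorem IsHalfSpace.sameGrowth (hH : IsHalfSpace C H a t) (hS : Subgroup.closure S = ⊤)
    (hfin : S.Finite) {U : Set G} {g : G} (hU : ∀ v, g⁻¹ * v ∈ H → v ∈ U) :
    SameGrowth (mulCayley S) U Set.univ := by
  have hconn := mulCayley_connected hS
  have ha : a ∈ H := by simpa using hH.swap 1 hH.one_notMem
  set o := g * a with ho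
  have hoU : o ∈ U := hU o (by simpa [ho] using ha)
  have hball : ∀ (X : Set G) n, ballIn (mulCayley S) X {o} n =
      {x | x ∈ X ∧ (mulCayley S).dist o x ≤ n} := by
    intro X n; ext x; simp [ballIn]
  have hbfin : ∀ (X : Set G) n, {x | x ∈ X ∧ (mulCayley S).dist o x ≤ n}.Finite :=
    fun X n => (mulCayley_finite_ball hS hfin o n).subset fun x hx => hx.2
  refine ⟨{o}, {o}, Set.finite_singleton o, Set.singleton_nonempty o, by simpa using hoU,
    Set.finite_singleton o, Set.singleton_nonempty o, Set.subset_univ _, ?_, ?_⟩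
  · refine ⟨1, one_pos, fun n => ?_⟩
    simp only [growthFunction, hball]
    have : {x | x ∈ U ∧ (mulCayley S).dist o x ≤ n} ⊆
        {x | x ∈ Set.univ ∧ (mulCayley S).dist o x ≤ 1 * n + 1} :=
      fun x hx => ⟨trivial, by have := hx.2; omega⟩
    have := Set.ncard_le_ncard this (hbfin _ _)
    omega
  -- `b` moves the complement of `g * H` into `g * H` and displaces `o` by `M`. Hence a ball about
  -- `o` is covered by two copies of a slightly larger ball in `U`.
  · set b := g * a * g⁻¹ with hb
    set M := (mulCayley S).dist o (b * o) with hM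
    refine ⟨M + 2, by omega, fun n => ?_⟩
    simp only [growthFunction, hball]
    set N := (M + 2) * n + (M + 2) with hN
    have hnN : n + M ≤ N := by nlinarith
    set B := {x | x ∈ U ∧ (mulCayley S).dist o x ≤ N} with hB
    have hsub : {x | x ∈ Set.univ ∧ (mulCayley S).dist o x ≤ n} ⊆ B ∪ (fun x => b⁻¹ * x) '' B := by
      rintro x ⟨-, hx⟩
      by_cases hxH : g⁻¹ * x ∈ H
      · exact .inl ⟨hU x hxH, by omega⟩
      · refine .inr ⟨b * x, ⟨hU _ ?_, ?_⟩, by simp⟩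
        · have := hH.swap _ hxH
          rwa [hb, show g⁻¹ * (g * a * g⁻¹ * x) = a * (g⁻¹ * x) by group]
        · have h1 := hconn.dist_triangle (u := o) (v := b * o) (w := b * x)
          rw [mulCayley_dist_mul_left hS] at h1
          omega
    have h1 := Set.ncard_le_ncard hsub ((hbfin U N).union ((hbfin U N).image _))
    have h2 := Set.ncard_union_le B ((fun x => b⁻¹ * x) '' B)
    have h3 : ((fun x => b⁻¹ * x) '' B).ncard ≤ B.ncard := Set.ncard_image_le (hbfin U N)
    have h4 : 2 * B.ncard ≤ (M + 2) * B.ncard := Nat.mul_le_mul_right _ (by omega)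
    omega

theorem IsHalfSpace.hasConstantRetainingProperty (hH : IsHalfSpace C H a t)
    (hCyc : IsVirtuallyCyclic C) (hQI : IsQuasiIsometricallyEmbedded C)
    (hS : Subgroup.closure S = ⊤) (hfin : S.Finite) :
    HasConstantRetainingProperty (mulCayley S) := by
  have hconn := mulCayley_connected hS
  choose F hF hFb using hH.boundary
  let E : Set G := ⋃ s ∈ S ∪ S⁻¹, F s
  have hE : E.Finite := (hfin.union hfin.inv).biUnion fun s _ => hF s
  obtain ⟨K, hK⟩ := exists_ncard_coset_inter_ball_le hCyc hQI hS hfin hE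
  -- The `+ 1` only ensures positivity. `K` was fixed before `X₀`, as the uniform constant requires.
  refine ⟨4 * K + 1, by omega, fun X₀ hX₀ => ?_⟩
  obtain ⟨D, hD⟩ := (Set.Finite.image2 (fun x y => (mulCayley S).dist x y) hX₀ hX₀).bddAbove
  -- Avoiding this set puts the boundary cosets at distance more than `D`, a bound on the diameter
  -- of `X₀`.
  have hY : (⋃ x ∈ X₀, Set.image2 (fun y e => y * e⁻¹)
      {y | (mulCayley S).dist x y ≤ D} E).Finite :=
    hX₀.biUnion fun x _ => (mulCayley_finite_ball hS hfin x D).image2 _ hE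
  obtain ⟨g, hgX, hgY⟩ := hH.exists_translate hX₀ hY
  have hfar : ∀ x ∈ X₀, ∀ c ∈ C, ∀ e ∈ E, D < (mulCayley S).dist x (g * (c * e)) := by
    intro x hx c hc e he
    by_contra! hle
    exact hgY c hc (Set.mem_biUnion hx ⟨g * (c * e), hle, e, he, by group⟩)
  have hborder : ∀ n, {v | (v ∈ {v | g⁻¹ * v ∈ H} ∧
        ∃ u, u ∉ {v | g⁻¹ * v ∈ H} ∧ (mulCayley S).Adj u v) ∧
        ∃ x ∈ X₀, (mulCayley S).dist x v ≤ n} ⊆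
      {v | (∃ c ∈ C, ∃ e ∈ E, v = g * (c * e)) ∧ ∃ x ∈ X₀, (mulCayley S).dist x v ≤ n} := by
    rintro n v ⟨⟨hv, u, hu, huv⟩, hx⟩
    refine ⟨?_, hx⟩
    simp only [Set.mem_ofPred_eq] at hv hu
    obtain ⟨c, hc, e, he, h⟩ := hFb (v⁻¹ * u) (g⁻¹ * v)
      (fun h => hu (by simpa [mul_assoc] using h.1 hv))
    refine ⟨c, hc, e, Set.mem_biUnion ?_ he, by rw [← h]; group⟩
    rcases ((mulCayley_adj S _ _).1 huv).2 with h | h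
    · exact .inr (by simpa using h)
    · exact .inl h
  have hballs : ∀ n, {v | ∃ x ∈ X₀, (mulCayley S).dist x v ≤ n}.Finite := by
    intro n
    refine (hX₀.biUnion fun x _ => mulCayley_finite_ball hS hfin x n).subset ?_
    rintro v ⟨x, hx, hv⟩
    exact Set.mem_biUnion hx hv
  have hfinite : ∀ n, {v | (∃ c ∈ C, ∃ e ∈ E, v = g * (c * e)) ∧
      ∃ x ∈ X₀, (mulCayley S).dist x v ≤ n}.Finite :=
    fun n => (hballs n).subset fun v hv => hv.2
  have hcount : ∀ n, {v | (∃ c ∈ C, ∃ e ∈ E, v = g * (c * e)) ∧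
      ∃ x ∈ X₀, (mulCayley S).dist x v ≤ n}.ncard ≤ (4 * K + 1) * n := by
    intro n
    rcases Set.eq_empty_or_nonempty {v | (∃ c ∈ C, ∃ e ∈ E, v = g * (c * e)) ∧
      ∃ x ∈ X₀, (mulCayley S).dist x v ≤ n} with h | ⟨_, ⟨c₀, hc₀, e₀, he₀, rfl⟩, x₀, hx₀, hn⟩
    · rw [h]; simp
    -- As `D < n`, recentring at a boundary point costs a radius of at most `n + D + n ≤ 3 * n`.
    -- Also `n ≥ 1`, whence `K * (3 * n + 1) ≤ 4 * K * n`.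
    have hDn := (hfar x₀ hx₀ c₀ hc₀ e₀ he₀).trans_le hn
    have hsub : {v | (∃ c ∈ C, ∃ e ∈ E, v = g * (c * e)) ∧
          ∃ x ∈ X₀, (mulCayley S).dist x v ≤ n} ⊆
        {v | (∃ c ∈ C, ∃ e ∈ E, v = g * (c * e)) ∧
          (mulCayley S).dist (g * (c₀ * e₀)) v ≤ 3 * n} := by
      rintro v ⟨hv, x, hx, hxv⟩
      refine ⟨hv, ?_⟩
      have h1 := hconn.dist_triangle (u := g * (c₀ * e₀)) (v := x₀) (w := v)
      have h2 := hconn.dist_triangle (u := x₀) (v := x) (w := v)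
      have h3 : (mulCayley S).dist x₀ x ≤ D := hD ⟨x₀, hx₀, x, hx, rfl⟩
      rw [dist_comm] at hn
      omega
    refine (Set.ncard_le_ncard hsub
      ((mulCayley_finite_ball hS hfin _ _).subset fun v hv => hv.2)).trans
      ((hK c₀ hc₀ e₀ he₀ g (3 * n)).trans ?_)
    nlinarith
  obtain ⟨W, hW, hsubset⟩ := exists_isStrategy_subset_neverOnFire hconn
    (H := {v | g⁻¹ * v ∈ H}) hgX (fun n => (hfinite n).subset (hborder n))
    (fun n => (Set.ncard_le_ncard (hborder n) (hfinite n)).trans (hcount n))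
  exact ⟨W, fun n _ => by simpa using hW n, hH.sameGrowth hS hfin fun v hv => hsubset hv⟩

end FireRetaining

theorem mainTheorem8 {G : Type*} [Group G] [Group.FG G] (A B C : Subgroup G)
    (hG : FireRetaining.IsAmalgamatedProduct A B C)
    (hCA : C < A) (hCB : C < B)
    (hCyc : FireRetaining.IsVirtuallyCyclic C)
    (hQI : FireRetaining.IsQuasiIsometricallyEmbedded C) :
    FireRetaining.GroupHasConstantRetainingProperty G := by
  obtain ⟨H, a, t, hH⟩ := hG.exists_isHalfSpace hCA hCB
  exact ⟨inferInstance, fun S hfin hS => hH.hasConstantRetainingProperty hCyc hQI hS hfin⟩
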